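/- Let $\mathbb T=[-\pi,\pi]$ with the end points identified, and let $0<\kappa<1$. Let $U_\kappa$ be the odd zero-up ground state of $\kappa^2u''+u-u^3=0$ on $\mathbb T$, that is, the $2\pi$-periodic odd $C^\infty$ solution $U_\kappa:\mathbb R\to\mathbb R$ of this equation on $\mathbb R$ such that $U_\kappa'(0)>0$, $U_\kappa$ is increasing on $[0,\frac\pi2]$, $U_\kappa'(\frac\pi2)=0$, $U_\kappa(\pi-x)=U_\kappa(x)$ for $\frac\pi2\le x\le\pi$, and $U_\kappa(\frac\pi2)=N_\kappa$, where $N_\kappa\in(0,1)$ is the unique number with $$\int_0^{\pi/2}\frac{d\theta}{\sqrt{2-N_\kappa^2(1+\sin^2\theta)}}=\frac{\pi}{2\sqrt2\,\kappa}.$$ Then there is a constant $C>0$, depending only on $\kappa$, such that for every $2\pi$-periodic odd real-valued function $\phi\in H^1(\mathbb T)$ $$\int_{\mathbb T}\kappa^2|\phi'|^2\,dx+\int_{\mathbb T}\bigl(3U_\kappa^2-1\bigr)|\phi|^2\,dx\ \ge\ C\,\|\phi\|_{H^1(\mathbb T)}^2 ,$$ where $\phi'$ is the weak derivative and $\|\phi\|_{H^1(\mathbb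 T)}^2=\int_{\mathbb T}(|\phi|^2+|\phi'|^2)\,dx$. -/

import Mathlib

open Real MeasureTheory
open scoped ContDiff

/-- The quarter-period integral
`g(N) = ∫₀^{π/2} dθ / √(2 - N² (1 + sin² θ))`, for `0 ≤ N < 1`. -/
noncomputable def amplitudeIntegral (N : ℝ) : ℝ :=
  ∫ θ in (0 : ℝ)..(π / 2), 1 / √(2 - N ^ 2 * (1 + sin θ ^ 2))

/-- `U` is the odd zero-up ground state `U_κ` of `κ² u'' + u - u³ = 0` on the torus of length `2π`:
the smooth `2π`-periodic odd solution with `U'(0) > 0` that is increasing on `[0, π/2]`, has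
`U'(π/2) = 0`, is symmetric about `π/2`, and whose maximum `U(π/2) = N_κ ∈ (0,1)` is the number
determined by `g(N_κ) = π / (2 √2 κ)`. (`U(0) = 0` follows from oddness.) -/
structure IsOddZeroUpGroundState (κ : ℝ) (U : ℝ → ℝ) : Prop where
  contDiff : ContDiff ℝ ∞ U
  periodic : Function.Periodic U (2 * π)
  odd : Function.Odd U
  steady : ∀ x, κ ^ 2 * deriv (deriv U) x + U x - U x ^ 3 = 0
  deriv_zero_pos : 0 < deriv U 0
  deriv_pi_div_two : deriv U (π / 2) = 0
  apply_pi_div_two : ∃ N : ℝ, 0 < N ∧ N < 1 ∧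
    amplitudeIntegral N = π / (2 * √2 * κ) ∧ U (π / 2) = N
  monotoneOn : MonotoneOn U (Set.Icc 0 (π / 2))
  reflect : ∀ x ∈ Set.Icc (π / 2) π, U (π - x) = U x

/-- `φ` is a (real-valued) element of `H¹(𝕋)`, `𝕋 = [-π, π]` with the end points identified, and `dφ`
is its weak derivative. Functions on `𝕋` are represented by `2π`-periodic functions on `ℝ`, and the
test functions are the smooth functions on `𝕋`, so that a jump of `φ` at `π` is not allowed. -/
structure IsH1Torus (φ dφ : ℝ → ℝ) : Prop where
  periodic : Function.Periodic φ (2 * π)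
  memLp : MemLp φ 2 (volume.restrict (Set.Ioc (-π) π))
  memLp_deriv : MemLp dφ 2 (volume.restrict (Set.Ioc (-π) π))
  weak_deriv : ∀ η : ℝ → ℝ, ContDiff ℝ ∞ η → Function.Periodic η (2 * π) →
    ∫ x in (-π)..π, φ x * deriv η x = -∫ x in (-π)..π, dφ x * η x

/-- The square of the `H¹(𝕋)` norm of a function `φ` with weak derivative `dφ`. -/
noncomputable def h1NormSq (φ dφ : ℝ → ℝ) : ℝ :=
  (∫ x in (-π)..π, φ x ^ 2) + ∫ x in (-π)..π, dφ x ^ 2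

/-! The odd zero-up ground state exists for every `κ ∈ (0, 1)`. -/

section Existence

open Set intervalIntegral Filter Topology

theorem amplitude_radicand_pos {N : ℝ} (h0 : 0 ≤ N) (h1 : N < 1) (θ : ℝ) : 0 < 2 - N ^ 2 * (1 + sin θ ^ 2) := by
  have h2 : sin θ ^ 2 ≤ 1 := sin_sq_le_one θ
  have h3 : N ^ 2 < 1 := by nlinarith
  nlinarith [sq_nonneg (sin θ), sq_nonneg N]

theorem amplitudeIntegral_lower {N : ℝ} (h0 : 0 ≤ N) (h1 : N < 1) :
    log ((√(2 - 2 * N ^ 2) + π / 2) / √(2 - 2 * N ^ 2)) ≤ amplitudeIntegral N := by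
  set δ := √(2 - 2 * N ^ 2) with hδ
  have hd2 : δ ^ 2 = 2 - 2 * N ^ 2 := sq_sqrt (by nlinarith)
  have hδ0 : 0 < δ := sqrt_pos.2 (by nlinarith)
  have e1 : ∫ θ in (0 : ℝ)..(π / 2), 1 / (δ + (π / 2 - θ)) = log ((δ + π / 2) / δ) := by
    have := integral_comp_sub_left (a := 0) (b := π / 2) (fun x => 1 / x) (δ + π / 2)
    simp only [add_sub_assoc] at this
    rw [this]
    rw [integral_one_div_of_pos (by linarith) (by rw [sub_zero]; linarith [pi_pos])]
    simp
  rw [← e1]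
  unfold amplitudeIntegral
  apply intervalIntegral.integral_mono_on (by positivity)
  · apply ContinuousOn.intervalIntegrable_of_Icc (by positivity)
    intro x hx
    apply ContinuousAt.continuousWithinAt
    have : δ + (π / 2 - x) ≠ 0 := by have := hx.2; exact (by linarith : 0 < δ + (π / 2 - x)).ne'
    fun_prop (disch := assumption)
  · apply Continuous.intervalIntegrable
    refine continuous_const.div (by fun_prop) fun x => (sqrt_pos.2 (amplitude_radicand_pos h0 h1 x)).ne'
  · intro x hx
    apply one_div_le_one_div_of_le (sqrt_pos.2 (amplitude_radicand_pos h0 h1 x))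
    apply sqrt_le_iff.2 ⟨by linarith [hx.2], ?_⟩
    have hc : cos x ^ 2 ≤ (π / 2 - x) ^ 2 := by
      rw [← sin_pi_div_two_sub]
      exact sq_le_sq' (by linarith [sin_nonneg_of_nonneg_of_le_pi (x := π / 2 - x) (by linarith [hx.2]) (by linarith [hx.1, pi_pos]), hx.2]) (sin_le (by linarith [hx.2]))
    have := sin_sq_add_cos_sq x
    nlinarith [sq_nonneg (cos x), mul_nonneg hδ0.le (sub_nonneg.2 hx.2), mul_nonneg (sub_nonneg.2 (show N ^ 2 ≤ 1 by nlinarith)) (sq_nonneg (cos x))]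

theorem exists_amplitude {κ : ℝ} (h0 : 0 < κ) (h1 : κ < 1) : ∃ N : ℝ, 0 < N ∧ N < 1 ∧
    amplitudeIntegral N = π / (2 * √2 * κ) := by
  have hz : amplitudeIntegral 0 = π / (2 * √2) := by
    simp [amplitudeIntegral]; field_simp
  have hlt : amplitudeIntegral 0 < π / (2 * √2 * κ) := by
    rw [hz]
    apply div_lt_div_of_pos_left pi_pos (by positivity)
    have : 0 < 2 * √2 := by positivity
    nlinarith
  set T := π / (2 * √2 * κ)
  have hT : 0 < T := by positivity
  obtain ⟨N, hN0, hN1, hN⟩ : ∃ N : ℝ, 0 ≤ N ∧ N < 1 ∧ T ≤ amplitudeIntegral N := by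
    have hE : 0 < exp (-T) := exp_pos _
    have hE1 : exp (-T) < 1 := by simpa using hT
    have hq : exp (-T) ^ 2 < 1 := by nlinarith
    refine ⟨√(1 - exp (-T) ^ 2 / 2), sqrt_nonneg _, ?_, ?_⟩
    · rw [sqrt_lt' one_pos]; nlinarith
    · have hlt1 : √(1 - exp (-T) ^ 2 / 2) < 1 := by rw [sqrt_lt' one_pos]; nlinarith
      refine le_trans ?_ (amplitudeIntegral_lower (sqrt_nonneg _) hlt1)
      rw [sq_sqrt (by linarith)]
      have : √(2 - 2 * (1 - exp (-T) ^ 2 / 2)) = exp (-T) := by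
        rw [show 2 - 2 * (1 - exp (-T) ^ 2 / 2) = exp (-T) ^ 2 by ring]
        exact sqrt_sq hE.le
      rw [this, le_log_iff_exp_le (by positivity), le_div_iff₀ hE, ← exp_add]
      simp
      linarith [two_le_pi]
  have hcont : ContinuousOn amplitudeIntegral (Icc 0 N) := by
    have hp : ContinuousOn (fun M : ℝ => ∫ θ in (0 : ℝ)..(π / 2),
        1 / √(2 - (min (max M 0) N) ^ 2 * (1 + sin θ ^ 2))) (Icc 0 N) := by
      apply Continuous.continuousOn
      apply intervalIntegral.continuous_parametric_intervalIntegral_of_continuous' 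
      refine continuous_const.div (by fun_prop) fun p => (sqrt_pos.2 (amplitude_radicand_pos ?_ ?_ p.2)).ne'
      · exact le_min (le_max_right _ _) hN0
      · exact (min_le_right _ _).trans_lt hN1
    refine hp.congr fun M hM => ?_
    simp [amplitudeIntegral, max_eq_left hM.1, min_eq_left hM.2]
  obtain ⟨M, hM, hMe⟩ := intermediate_value_Icc hN0 hcont ⟨hlt.le, hN⟩
  refine ⟨M, lt_of_le_of_ne hM.1 ?_, hM.2.trans_lt hN1, hMe⟩
  rintro rfl
  exact hlt.ne hMe

theorem exists_isOddZeroUpGroundState {κ : ℝ} (h0 : 0 < κ) (h1 : κ < 1) : ∃ U, IsOddZeroUpGroundState κ U := by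
  obtain ⟨N, hN0, hN1, hN⟩ := exists_amplitude h0 h1
  set f : ℝ → ℝ := fun θ => 2 - N ^ 2 * (1 + sin θ ^ 2) with hf
  have fp : ∀ θ, 0 < f θ := amplitude_radicand_pos hN0.le hN1
  have hs : ∀ θ, f θ ≠ 0 := fun θ => (fp θ).ne'
  have sp : ∀ θ, 0 < √(f θ) := fun θ => sqrt_pos.2 (fp θ)
  have s2 : 0 < √2 := by positivity
  have s22 : √2 ^ 2 = 2 := sq_sqrt (by norm_num)
  have hfc : Continuous fun θ => √2 * κ * (1 / √(f θ)) :=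
    continuous_const.mul (continuous_const.div (by fun_prop) fun x => (sp x).ne')
  set X : ℝ → ℝ := fun θ => ∫ t in (0 : ℝ)..θ, √2 * κ * (1 / √(f t)) with hX
  have dX : ∀ θ, HasDerivAt X (√2 * κ * (1 / √(f θ))) θ := fun θ =>
    integral_hasDerivAt_right (hfc.intervalIntegrable _ _)
      (hfc.stronglyMeasurableAtFilter _ _) hfc.continuousAt
  have X0 : X 0 = 0 := by simp [hX]
  have Xh : X (π / 2) = π / 2 := by
    simp only [hX]
    rw [intervalIntegral.integral_const_mul]
    have : ∫ t in (0 : ℝ)..(π / 2), 1 / √(f t) = amplitudeIntegral N := rfl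
    rw [this, hN]; field_simp
  have Xodd : ∀ θ, X (-θ) = - X θ := by
    have hd : ∀ θ, HasDerivAt (fun t => X (-t) + X t) 0 θ := fun θ => by
      have := ((dX (-θ)).comp θ (hasDerivAt_neg θ)).add (dX θ)
      refine this.congr_deriv ?_
      simp [hf]
    have := is_const_of_deriv_eq_zero (fun θ => (hd θ).differentiableAt) fun θ => (hd θ).deriv
    intro θ
    have := this θ 0
    simp [X0] at this
    linarith
  have Xrefl : ∀ θ, X (π - θ) = π - X θ := by
    have hd : ∀ θ, HasDerivAt (fun t => X (π - t) + X t) 0 θ := fun θ => by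
      have := ((dX (π - θ)).comp θ ((hasDerivAt_id θ).const_sub π)).add (dX θ)
      refine this.congr_deriv ?_
      simp [hf]
    have := is_const_of_deriv_eq_zero (fun θ => (hd θ).differentiableAt) fun θ => (hd θ).deriv
    intro θ
    have := this θ (π / 2)
    simp only [show π - π / 2 = π / 2 by ring, Xh] at this
    linarith
  have Xmono : StrictMono X := strictMono_of_deriv_pos fun θ => by
    rw [(dX θ).deriv]; have := sp θ; positivity
  have Xcont : Continuous X := continuous_iff_continuousAt.2 fun θ => (dX θ).continuousAt
  have Xadd : ∀ θ, X (θ + π) = X θ + π := fun θ => by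
    have := Xrefl (-θ); rw [Xodd] at this
    rw [add_comm, ← sub_neg_eq_add, this]; ring
  have Xn : ∀ n : ℕ, X (n * π) = n * π := fun n => by
    induction n with
    | zero => simp [X0]
    | succ n ih => push_cast; rw [add_mul, one_mul, Xadd, ih]
  have Xsurj : Function.Surjective X := by
    intro y
    obtain ⟨n, hn⟩ := exists_nat_ge |y|
    have h3 : (n : ℝ) ≤ n * π := by nlinarith [two_le_pi, (Nat.cast_nonneg n : (0 : ℝ) ≤ n)]
    have hy := abs_le.1 (hn.trans h3)
    have := intermediate_value_Icc (a := -(n * π)) (b := n * π) (by linarith [abs_nonneg y])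
      Xcont.continuousOn
    rw [Xodd, Xn] at this
    obtain ⟨θ, -, h⟩ := this hy
    exact ⟨θ, h⟩
  set e := (Xmono.orderIsoOfSurjective X Xsurj).toHomeomorph with he
  set Θ : ℝ → ℝ := fun x => e.symm x with hΘ
  have XΘ : ∀ x, X (Θ x) = x := fun x => e.apply_symm_apply x
  have ΘX : ∀ x, Θ (X x) = x := fun x => e.symm_apply_apply x
  have dΘ : ∀ x, HasDerivAt Θ (√(f (Θ x)) / (√2 * κ)) x := fun x => by
    have h := (dX (Θ x)).of_local_left_inverse (g := Θ) (a := x) e.symm.continuous.continuousAt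
      (by have := sp (Θ x); positivity) (Filter.Eventually.of_forall XΘ)
    refine h.congr_deriv ?_
    rw [one_div, ← div_eq_mul_inv, inv_div]
  have Θodd : ∀ x, Θ (-x) = - Θ x := fun x => Xmono.injective (by rw [XΘ, Xodd, XΘ])
  have Θrefl : ∀ x, Θ (π - x) = π - Θ x := fun x => Xmono.injective (by rw [XΘ, Xrefl, XΘ])
  have Θadd : ∀ x, Θ (x + π) = Θ x + π := fun x => Xmono.injective (by rw [XΘ, Xadd, XΘ])
  have Θ0 : Θ 0 = 0 := by rw [← X0, ΘX, X0]
  have Θh : Θ (π / 2) = π / 2 := by nth_rewrite 1 [← Xh]; rw [ΘX]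
  have dΘ' : deriv Θ = fun x => √(f (Θ x)) / (√2 * κ) := funext fun x => (dΘ x).deriv
  have Θsm : ContDiff ℝ ∞ Θ := by
    rw [contDiff_infty]
    intro n
    induction n with
    | zero => exact contDiff_zero.2 e.symm.continuous
    | succ n ih =>
      push_cast
      rw [contDiff_succ_iff_deriv]
      refine ⟨fun x => (dΘ x).differentiableAt, by simp, ?_⟩
      rw [dΘ']
      refine ContDiff.div_const (ContDiff.sqrt ?_ fun x => hs _) _
      simp only [hf]
      exact contDiff_const.sub (contDiff_const.mul (contDiff_const.add ((contDiff_sin.comp ih).pow 2)))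
  set U : ℝ → ℝ := fun x => N * sin (Θ x) with hU
  have dU : ∀ x, HasDerivAt U (N * (cos (Θ x) * (√(f (Θ x)) / (√2 * κ)))) x := fun x =>
    ((dΘ x).sin).const_mul N
  have dU' : deriv U = fun x => N * (cos (Θ x) * (√(f (Θ x)) / (√2 * κ))) :=
    funext fun x => (dU x).deriv
  refine ⟨U, ?_, ?_, ?_, ?_, ?_, ?_, ?_, ?_, ?_⟩
  · exact contDiff_const.mul (contDiff_sin.comp Θsm)
  · intro x
    simp only [hU]
    rw [show x + 2 * π = x + π + π by ring, Θadd, Θadd, sin_add_pi, sin_add_pi, neg_neg]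
  · intro x
    simp [hU, Θodd]
  · intro x
    have hff : HasDerivAt (fun x => f (Θ x))
        (-(N ^ 2 * (2 * sin (Θ x) * (cos (Θ x) * (√(f (Θ x)) / (√2 * κ)))))) x := by
      simp only [hf]
      have := (((((dΘ x).sin).pow 2).const_add 1).const_mul (N ^ 2)).const_sub 2
      refine this.congr_deriv ?_
      ring
    have h2 := (((dΘ x).cos).mul ((hff.sqrt (hs _)).div_const (√2 * κ))).const_mul N
    rw [dU']
    have h3 := h2.deriv
    simp only [Pi.mul_def] at h3
    rw [h3]
    have hsq : √(f (Θ x)) ^ 2 = 2 - N ^ 2 * (1 + sin (Θ x) ^ 2) := sq_sqrt (fp _).le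
    have hsp := (sp (Θ x)).ne'
    have hcs := sin_sq_add_cos_sq (Θ x)
    simp only [hU]
    generalize √(f (Θ x)) = r at *
    field_simp
    simp only [s22]
    have hc2 : cos (Θ x) ^ 2 = 1 - sin (Θ x) ^ 2 := by linarith
    rw [hsq, hc2]
    ring
  · rw [dU']
    simp only [Θ0, cos_zero]
    have := sp 0
    positivity
  · rw [dU']
    simp [Θh]
  · exact ⟨N, hN0, hN1, hN, by simp [hU, Θh]⟩
  · intro x hx y hy hxy
    have Θm : Monotone Θ := (Xmono.orderIsoOfSurjective X Xsurj).symm.monotone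
    have a1 := Θm hx.1
    have a2 := Θm hy.2
    rw [Θ0] at a1
    rw [Θh] at a2
    exact mul_le_mul_of_nonneg_left (sin_le_sin_of_le_of_le_pi_div_two (by linarith [pi_pos]) a2 (Θm hxy)) hN0.le
  · intro x _
    simp [hU, Θrefl]

end Existence

/-!
Write `L = -κ² ∂² + (3 U² - 1)`. The ground state `U` is positive on `(0, π)` and, by its equation,
`L U = 2 U³`, so it is a supersolution whose defect and whose values degenerate only at `0` and
`π`. Adding a small multiple of `h = κ² - sin²`, which at these points has `h = L h = κ² > 0`,
gives a function `w` with `w > 0` and `L w ≥ c w` on the closed interval `[0, π]`, for some `c > 0`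
(`IsOddZeroUpGroundState.exists_supersolution`).

An odd `φ ∈ H¹(𝕋)` has an absolutely continuous representative vanishing at `-π`, `0` and `π`
(`IsH1Torus.exists_absolutelyContinuous_rep_of_odd`). Picone's inequality
(`AbsolutelyContinuousOnInterval.mul_integral_sq_le_of_supersolution`), used with `w` on `[0, π]`
and with its reflection on `[-π, 0]`, bounds the quadratic form of `L` below by `c ∫ φ²`. Because
the weight `w` does not vanish at the end points, no Hardy-type inequality is needed.
A convex combination with the trivial bound `κ² ∫ φ'² - ∫ φ²` gives the `H¹` norm.

The constant depends on `κ` only because `U` does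
(`IsOddZeroUpGroundState.unique`): the amplitude integral is strictly increasing, so it determines
`U (π / 2)`, and `U' (π / 2) = 0` supplies the rest of the initial data.
-/

/-! ### Monotonicity of the amplitude integral, and perturbation on compact sets -/

theorem amplitudeIntegral_strictMonoOn : StrictMonoOn amplitudeIntegral (Set.Ico 0 1) := by
  have hc : ∀ N : ℝ, 0 ≤ N → N < 1 → Continuous fun θ => 1 / √(2 - N ^ 2 * (1 + sin θ ^ 2)) :=
    fun N h0 h1 => continuous_const.div (by fun_prop)
      fun x => (sqrt_pos.2 (amplitude_radicand_pos h0 h1 x)).ne'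
  intro M hM N hN hMN
  have hsq : M ^ 2 < N ^ 2 := by nlinarith [hM.1, hN.1]
  have key : ∀ θ, 1 / √(2 - M ^ 2 * (1 + sin θ ^ 2)) < 1 / √(2 - N ^ 2 * (1 + sin θ ^ 2)) := by
    intro θ
    have hN' := amplitude_radicand_pos hN.1 hN.2 θ
    apply one_div_lt_one_div_of_lt (sqrt_pos.2 hN')
    apply sqrt_lt_sqrt hN'.le
    nlinarith [sq_nonneg (sin θ)]
  exact intervalIntegral.integral_lt_integral_of_continuousOn_of_le_of_exists_lt (by positivity)
    (hc M hM.1 hM.2).continuousOn (hc N hN.1 hN.2).continuousOn (fun θ _ => (key θ).le)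
    ⟨0, ⟨le_rfl, by positivity⟩, key 0⟩

/-- If `f ≥ 0` on a compact set and `g > 0` wherever `f` vanishes there, then `f + δ g > 0` on that
set for all small `δ > 0`. -/
theorem IsCompact.exists_forall_add_mul_pos {X : Type*} [TopologicalSpace X] [T2Space X]
    {K : Set X} (hK : IsCompact K) {f g : X → ℝ}
    (hf : ContinuousOn f K) (hg : ContinuousOn g K) (hf0 : ∀ x ∈ K, 0 ≤ f x)
    (hfg : ∀ x ∈ K, f x = 0 → 0 < g x) :
    ∃ δ₀ > 0, ∀ δ, 0 < δ → δ ≤ δ₀ → ∀ x ∈ K, 0 < f x + δ * g x := by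
  -- Off the set where `g > 0`, `f` has a positive minimum `m` and `|g|` is at most some `B`.
  have hK' : IsCompact {x ∈ K | g x ≤ 0} := by
    have := hg.preimage_isClosed_of_isClosed hK.isClosed (isClosed_Iic (a := (0 : ℝ)))
    exact hK.of_isClosed_subset this fun x hx => hx.1
  obtain ⟨B, hB⟩ := hK.exists_bound_of_continuousOn hg
  obtain ⟨m, hm0, hm⟩ : ∃ m > 0, ∀ x ∈ K, g x ≤ 0 → m ≤ f x := by
    rcases Set.eq_empty_or_nonempty {x ∈ K | g x ≤ 0} with he | hne
    · exact ⟨1, one_pos, fun x hx hgx => (Set.eq_empty_iff_forall_notMem.1 he x ⟨hx, hgx⟩).elim⟩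
    · obtain ⟨y, hy, hmin⟩ := hK'.exists_isMinOn hne (hf.mono fun x hx => hx.1)
      refine ⟨f y, lt_of_le_of_ne (hf0 y hy.1) fun h => ?_, fun x hx hgx => hmin ⟨hx, hgx⟩⟩
      exact (hfg y hy.1 h.symm).not_ge hy.2
  refine ⟨m / (|B| + 1), by positivity, fun δ hδ hδ' x hx => ?_⟩
  rcases lt_or_ge 0 (g x) with hgx | hgx
  · have := hf0 x hx
    positivity
  · have h1 := hm x hx hgx
    have h2 : -g x < |B| + 1 := by
      have := hB x hx
      rw [Real.norm_eq_abs] at this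
      linarith [neg_le_abs (g x), le_abs_self B]
    have h3 : δ * (|B| + 1) ≤ m := by rwa [le_div_iff₀ (by positivity)] at hδ'
    nlinarith

/-! ### The ground state: uniqueness, positivity and a supersolution -/

namespace IsOddZeroUpGroundState

variable {κ : ℝ} {U V : ℝ → ℝ}

theorem hasDerivAt (hU : IsOddZeroUpGroundState κ U) (x : ℝ) : HasDerivAt U (deriv U x) x :=
  (hU.contDiff.differentiable (by simp) x).hasDerivAt

theorem contDiff_deriv (hU : IsOddZeroUpGroundState κ U) : ContDiff ℝ ∞ (deriv U) :=
  ((contDiff_infty_iff_deriv).1 hU.contDiff).2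

theorem hasDerivAt_deriv (hU : IsOddZeroUpGroundState κ U) (x : ℝ) :
    HasDerivAt (deriv U) (deriv (deriv U) x) x :=
  (hU.contDiff_deriv.differentiable (by simp) x).hasDerivAt

theorem apply_zero (hU : IsOddZeroUpGroundState κ U) : U 0 = 0 := by
  have := hU.odd 0
  simp only [neg_zero] at this
  linarith

theorem exists_bound (hU : IsOddZeroUpGroundState κ U) :
    ∃ R, ∀ x, (U x, deriv U x) ∈ Metric.closedBall (0 : ℝ × ℝ) R := by
  have hper : Function.Periodic (fun x => (U x, deriv U x)) (2 * π) := fun x => by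
    have h : deriv U (x + 2 * π) = deriv U x := by
      rw [← deriv_comp_add_const U (2 * π) x]
      congr 1
      exact funext hU.periodic
    exact Prod.ext (hU.periodic x) h
  have hcont : Continuous fun x => (U x, deriv U x) :=
    hU.contDiff.continuous.prodMk hU.contDiff_deriv.continuous
  obtain ⟨R, hR⟩ := (hper.compact_of_continuous (by positivity) hcont).isBounded.subset_closedBall 0
  exact ⟨R, fun x => hR ⟨x, rfl⟩⟩

/-- The ground state is determined by `κ`: its amplitude is, since `amplitudeIntegral` is strictly
increasing, and then it solves an initial value problem at `π / 2`. -/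
theorem unique (hκ : κ ≠ 0) (hU : IsOddZeroUpGroundState κ U) (hV : IsOddZeroUpGroundState κ V) :
    U = V := by
  obtain ⟨N, hN0, hN1, hN, hUN⟩ := hU.apply_pi_div_two
  obtain ⟨M, hM0, hM1, hM, hVM⟩ := hV.apply_pi_div_two
  obtain rfl : N = M := amplitudeIntegral_strictMonoOn.injOn ⟨hN0.le, hN1⟩ ⟨hM0.le, hM1⟩
    (hN.trans hM.symm)
  let v : ℝ × ℝ → ℝ × ℝ := fun p => (p.2, (p.1 ^ 3 - p.1) / κ ^ 2)
  have hv : ContDiff ℝ 1 v := by fun_prop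
  obtain ⟨R, hR⟩ := hU.exists_bound
  obtain ⟨S, hS⟩ := hV.exists_bound
  obtain ⟨K, hK⟩ := LocallyLipschitzOn.exists_lipschitzOnWith_of_compact
    (isCompact_closedBall (0 : ℝ × ℝ) (max R S)) hv.locallyLipschitz.locallyLipschitzOn
  have hsol : ∀ {W : ℝ → ℝ}, IsOddZeroUpGroundState κ W → ∀ t,
      HasDerivAt (fun x => (W x, deriv W x)) (v (W t, deriv W t)) t := fun {W} hW t => by
    have h : deriv (deriv W) t = (W t ^ 3 - W t) / κ ^ 2 := by
      rw [eq_div_iff (pow_ne_zero 2 hκ)]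
      linarith [hW.steady t]
    have := (hW.hasDerivAt t).prodMk (hW.hasDerivAt_deriv t)
    rwa [h] at this
  have := ODE_solution_unique_univ (v := fun _ => v)
    (s := fun _ => Metric.closedBall (0 : ℝ × ℝ) (max R S)) (t₀ := π / 2) (fun _ => hK)
    (fun t => ⟨hsol hU t, Metric.closedBall_subset_closedBall (le_max_left _ _) (hR t)⟩)
    (fun t => ⟨hsol hV t, Metric.closedBall_subset_closedBall (le_max_right _ _) (hS t)⟩)
    (by simp [hUN, hVM, hU.deriv_pi_div_two, hV.deriv_pi_div_two])
  exact funext fun x => congrArg Prod.fst (congrFun this x)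

theorem pos_of_mem_Ioc (hU : IsOddZeroUpGroundState κ U) {x : ℝ} (hx : x ∈ Set.Ioc 0 (π / 2)) :
    0 < U x := by
  have h : ∀ᶠ y in nhdsWithin 0 (Set.Ioi 0), 0 < U y := by
    have hs := eventually_nhdsWithin_sign_eq_of_deriv_pos hU.deriv_zero_pos hU.apply_zero
    filter_upwards [hs.filter_mono nhdsWithin_le_nhds, self_mem_nhdsWithin] with y hy hy0
    rwa [sub_zero, sign_pos (Set.mem_Ioi.1 hy0 : 0 < y), sign_eq_one_iff] at hy
  obtain ⟨y, hy, hyx⟩ := (h.and (Ioc_mem_nhdsGT hx.1)).exists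
  exact hy.trans_le (hU.monotoneOn ⟨hyx.1.le, hyx.2.trans hx.2⟩ ⟨hx.1.le, hx.2⟩ hyx.2)

theorem pos_of_mem_Ioo (hU : IsOddZeroUpGroundState κ U) {x : ℝ} (hx : x ∈ Set.Ioo 0 π) :
    0 < U x := by
  rcases le_total x (π / 2) with h | h
  · exact hU.pos_of_mem_Ioc ⟨hx.1, h⟩
  · rw [← hU.reflect x ⟨h, hx.2.le⟩]
    exact hU.pos_of_mem_Ioc ⟨by linarith [hx.2], by linarith⟩

theorem apply_pi (hU : IsOddZeroUpGroundState κ U) : U π = 0 := by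
  rw [← hU.reflect π ⟨by linarith [pi_pos], le_rfl⟩, sub_self, hU.apply_zero]

theorem nonneg_of_mem_Icc (hU : IsOddZeroUpGroundState κ U) {x : ℝ} (hx : x ∈ Set.Icc 0 π) :
    0 ≤ U x := by
  rcases hx.1.eq_or_lt with rfl | h0
  · exact hU.apply_zero.ge
  rcases hx.2.eq_or_lt with rfl | h1
  · exact hU.apply_pi.ge
  · exact (hU.pos_of_mem_Ioo ⟨h0, h1⟩).le

/-- A strictly positive strict supersolution on `[0, π]` of the linearization
`-κ² ∂² + (3 U² - 1)`. -/
theorem exists_supersolution (hκ : 0 < κ) (hU : IsOddZeroUpGroundState κ U) :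
    ∃ w : ℝ → ℝ, ContDiff ℝ 2 w ∧ (∀ x ∈ Set.Icc 0 π, 0 < w x) ∧
      ∃ c > 0, ∀ x ∈ Set.Icc 0 π,
        c * w x ≤ (3 * U x ^ 2 - 1) * w x - κ ^ 2 * deriv (deriv w) x := by
  have hUc : Continuous U := hU.contDiff.continuous
  -- `U` itself is a supersolution with defect `2 U³`, which degenerates at the end points only.
  -- There the corrector `h = κ² - sin²` is positive and has defect `2 κ² - κ² > 0`.
  let h : ℝ → ℝ := fun x => κ ^ 2 - sin x ^ 2
  let Lh : ℝ → ℝ := fun x => (3 * U x ^ 2 - 1) * h x + 2 * κ ^ 2 * (1 - 2 * sin x ^ 2)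
  have hend : ∀ x ∈ Set.Icc 0 π, U x = 0 → sin x = 0 := by
    intro x hx hUx
    by_contra hs
    refine (hU.pos_of_mem_Ioo ⟨lt_of_le_of_ne hx.1 ?_, lt_of_le_of_ne hx.2 ?_⟩).ne' hUx
    · rintro rfl; simp at hs
    · rintro rfl; simp at hs
  obtain ⟨δ₁, hδ₁, H₁⟩ := isCompact_Icc.exists_forall_add_mul_pos (K := Set.Icc 0 π) (f := U)
    (g := h) hUc.continuousOn (by fun_prop) (fun x hx => hU.nonneg_of_mem_Icc hx) (by
      intro x hx hUx
      simp only [h, hend x hx hUx]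
      nlinarith [pow_pos hκ 2])
  obtain ⟨δ₂, hδ₂, H₂⟩ := isCompact_Icc.exists_forall_add_mul_pos (K := Set.Icc 0 π)
    (f := fun x => 2 * U x ^ 3) (g := Lh) (by fun_prop) (by fun_prop)
    (fun x hx => by have := hU.nonneg_of_mem_Icc hx; positivity) (by
      intro x hx hUx
      have hUx' : U x = 0 := by simpa using hUx
      simp only [Lh, h, hend x hx hUx', hUx']
      nlinarith [pow_pos hκ 2])
  set δ := min δ₁ δ₂
  have hδ : 0 < δ := lt_min hδ₁ hδ₂
  let w : ℝ → ℝ := fun x => U x + δ * h x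
  have hwpos : ∀ x ∈ Set.Icc 0 π, 0 < w x := H₁ δ hδ (min_le_left _ _)
  have dw : deriv w = fun x => deriv U x + δ * -(2 * sin x * cos x) := by
    funext x
    have := (hU.hasDerivAt x).add ((((hasDerivAt_sin x).pow 2).const_sub (κ ^ 2)).const_mul δ)
    refine (this.congr_deriv ?_).deriv
    ring
  have ddw : ∀ x, deriv (deriv w) x = deriv (deriv U) x + δ * -(2 * (1 - 2 * sin x ^ 2)) := by
    intro x
    rw [dw]
    have := (hU.hasDerivAt_deriv x).add
      ((((hasDerivAt_sin x).const_mul 2).mul (hasDerivAt_cos x)).neg.const_mul δ)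
    refine (this.congr_deriv ?_).deriv
    have := cos_sq' x
    linear_combination (-2 * δ) * this
  have hLw : ∀ x, (3 * U x ^ 2 - 1) * w x - κ ^ 2 * deriv (deriv w) x
      = 2 * U x ^ 3 + δ * Lh x := by
    intro x
    rw [ddw]
    simp only [w, Lh]
    linear_combination -hU.steady x
  have hwc : Continuous w := by fun_prop
  refine ⟨w, (hU.contDiff.of_le (by norm_cast)).add (by fun_prop), hwpos, ?_⟩
  obtain ⟨y, hy, hmin⟩ := isCompact_Icc.exists_isMinOn (s := Set.Icc 0 π)
    (f := fun x => (2 * U x ^ 3 + δ * Lh x) / w x) ⟨0, le_rfl, pi_pos.le⟩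
    (ContinuousOn.div (by fun_prop) hwc.continuousOn fun x hx => (hwpos x hx).ne')
  refine ⟨_, div_pos (H₂ δ hδ (min_le_right _ _) y hy) (hwpos y hy), fun x hx => ?_⟩
  rw [hLw, ← le_div_iff₀ (hwpos x hx)]
  exact hmin hx

end IsOddZeroUpGroundState

/-! ### Picone's inequality -/

/-- **Picone's inequality**: a positive `w` with `-κ² w'' + V w ≥ c w` on `[a, b]` bounds the
Dirichlet form of `-κ² ∂² + V` below by `c`. One integrates the derivative of `f² w' / w`, whose
boundary values vanish. -/
theorem AbsolutelyContinuousOnInterval.mul_integral_sq_le_of_supersolution {a b κ c : ℝ}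
    {f d V w : ℝ → ℝ} (hab : a ≤ b) (hf : AbsolutelyContinuousOnInterval f a b)
    (hd : ∀ᵐ x, x ∈ Set.uIcc a b → HasDerivAt f (d x) x)
    (hd2 : IntervalIntegrable (fun x => d x ^ 2) volume a b)
    (ha : f a = 0) (hb : f b = 0) (hV : Continuous V) (hw : ContDiff ℝ 2 w)
    (hw0 : ∀ x ∈ Set.Icc a b, 0 < w x)
    (hc : ∀ x ∈ Set.Icc a b, c * w x ≤ V x * w x - κ ^ 2 * deriv (deriv w) x) :
    c * ∫ x in a..b, f x ^ 2 ≤ ∫ x in a..b, κ ^ 2 * d x ^ 2 + V x * f x ^ 2 := by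
  have huIcc : Set.uIcc a b = Set.Icc a b := Set.uIcc_of_le hab
  have hw' : ContDiff ℝ 1 (deriv w) := ((contDiff_succ_iff_deriv (n := 1)).1 hw).2.2
  let r : ℝ → ℝ := fun x => deriv w x / w x
  have hr : ContDiffOn ℝ 1 r (Set.uIcc a b) := by
    rw [huIcc]
    exact hw'.contDiffOn.div (hw.of_le (by norm_num)).contDiffOn fun x hx => (hw0 x hx).ne'
  have hg : AbsolutelyContinuousOnInterval (fun x => f x * f x * r x) a b :=
    (hf.fun_mul hf).fun_mul hr.absolutelyContinuousOnInterval
  have hg0 : ∫ x in a..b, deriv (fun x => f x * f x * r x) x = 0 := by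
    rw [hg.integral_deriv_eq_sub, ha, hb]
    ring
  have hfc : ContinuousOn f (Set.uIcc a b) := hf.continuousOn
  have hi1 : IntervalIntegrable (fun x => c * f x ^ 2) volume a b :=
    ContinuousOn.intervalIntegrable (by fun_prop)
  have hi2 : IntervalIntegrable (fun x => κ ^ 2 * d x ^ 2 + V x * f x ^ 2) volume a b :=
    (hd2.const_mul _).add (ContinuousOn.intervalIntegrable (by fun_prop))
  have hi3 := hg.intervalIntegrable_deriv.const_mul (κ ^ 2)
  have hle : ∫ x in a..b, (c * f x ^ 2 + κ ^ 2 * deriv (fun x => f x * f x * r x) x) ≤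
      ∫ x in a..b, κ ^ 2 * d x ^ 2 + V x * f x ^ 2 := by
    apply intervalIntegral.integral_mono_ae_restrict hab (hi1.add hi3) hi2
    rw [Filter.EventuallyLE, ae_restrict_iff' measurableSet_Icc]
    filter_upwards [hd] with x hx hxI
    have hfx := hx (huIcc ▸ hxI)
    have hwx := hw0 x hxI
    have h1 : HasDerivAt w (deriv w x) x := (hw.differentiable (by norm_num) x).hasDerivAt
    have h2 : HasDerivAt (deriv w) (deriv (deriv w) x) x :=
      (hw'.differentiable (by norm_num) x).hasDerivAt
    have h3 := ((hfx.mul hfx).mul (h2.div h1 hwx.ne')).deriv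
    have h4 : c ≤ V x - κ ^ 2 * (deriv (deriv w) x / w x) := by
      rw [← mul_le_mul_iff_left₀ hwx]
      refine (hc x hxI).trans_eq ?_
      field_simp
    have h5 : deriv (fun x => f x * f x * r x) x = 2 * f x * d x * (deriv w x / w x)
        + f x ^ 2 * (deriv (deriv w) x / w x - (deriv w x / w x) ^ 2) := by
      refine h3.trans ?_
      simp only [Pi.mul_apply, Pi.div_apply]
      field_simp
      ring
    rw [h5]
    -- The difference of the two sides is `κ² (d - (w'/w) f)²` plus the defect times `f²`.
    nlinarith [mul_nonneg (sq_nonneg κ) (sq_nonneg (d x - deriv w x / w x * f x)),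
      mul_nonneg (sub_nonneg.2 h4) (sq_nonneg (f x))]
  rw [intervalIntegral.integral_add hi1 hi3, intervalIntegral.integral_const_mul,
    intervalIntegral.integral_const_mul, hg0, mul_zero, add_zero] at hle
  exact hle

/-! ### Absolutely continuous representatives in `H¹(𝕋)` -/

/-- The **du Bois-Reymond lemma** on the torus, for square integrable functions: testing with
`sin (n x)` and `cos (n x)` shows that all Fourier coefficients of `ψ` but the zeroth vanish. -/
theorem ae_eq_const_of_integral_mul_deriv_eq_zero {ψ : ℝ → ℝ}
    (hψ : MemLp ψ 2 (volume.restrict (Set.Ioc (-π) π)))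
    (h : ∀ η : ℝ → ℝ, ContDiff ℝ ∞ η → Function.Periodic η (2 * π) →
      ∫ x in (-π)..π, ψ x * deriv η x = 0) :
    ∃ c : ℝ, ∀ᵐ x ∂(volume.restrict (Set.Ioc (-π) π)), ψ x = c := by
  have hlt : -π < π := by linarith [pi_pos]
  set c := (∫ x in (-π)..π, ψ x) / (2 * π) with hc
  have hψi : IntervalIntegrable ψ volume (-π) π :=
    (intervalIntegrable_iff_integrableOn_Ioc_of_le hlt.le).2 (hψ.integrable (by norm_num))
  let F : ℝ → ℂ := fun x => ((ψ x - c : ℝ) : ℂ)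
  have hψc : MemLp (fun x => ψ x - c) 2 (volume.restrict (Set.Ioc (-π) π)) :=
    hψ.sub (memLp_const c)
  have hF : MemLp F 2 (volume.restrict (Set.Ioc (-π) π)) := hψc.ofReal
  have hmul : ∀ η : ℝ → ℝ, ContDiff ℝ ∞ η → Function.Periodic η (2 * π) →
      ∫ x in (-π)..π, deriv η x * (ψ x - c) = 0 := by
    intro η hη hper
    have hη' : Continuous (deriv η) := hη.continuous_deriv (by simp)
    have h0 : ∫ x in (-π)..π, deriv η x = 0 := by
      rw [intervalIntegral.integral_deriv_eq_sub (fun x _ => hη.differentiable (by simp) x)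
        (hη'.intervalIntegrable _ _), ← hper (-π)]
      ring_nf
    have := h η hη hper
    calc ∫ x in (-π)..π, deriv η x * (ψ x - c)
        = ∫ x in (-π)..π, (ψ x * deriv η x - c * deriv η x) := by congr 1; ext x; ring
      _ = 0 := by
        rw [intervalIntegral.integral_sub (hψi.mul_continuousOn hη'.continuousOn)
          ((hη'.intervalIntegrable _ _).const_mul c), this, intervalIntegral.integral_const_mul, h0]
        ring
  have hcos : ∀ n : ℤ, ∫ x in (-π)..π, cos (n * x) * (ψ x - c) = 0 := by
    intro n
    rcases eq_or_ne n 0 with rfl | hn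
    · simp only [Int.cast_zero, zero_mul, cos_zero, one_mul]
      rw [intervalIntegral.integral_sub hψi (by simp), intervalIntegral.integral_const, hc]
      have := pi_ne_zero
      simp only [smul_eq_mul]
      field_simp
      ring
    · have hn' : (n : ℝ) ≠ 0 := by exact_mod_cast hn
      have := hmul (fun x => sin (n * x) / n) (by fun_prop) (fun x => by
        simp only
        rw [show (n : ℝ) * (x + 2 * π) = n * x + n * (2 * π) by ring, sin_add_int_mul_two_pi])
      have hd : ∀ x, deriv (fun x => sin (n * x) / n) x = cos (n * x) := fun x => by
        have := (((hasDerivAt_id x).const_mul (n : ℝ)).sin.div_const (n : ℝ)).deriv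
        simp only [id] at this
        rw [this]
        field_simp
      simpa only [hd] using this
  have hsin : ∀ n : ℤ, ∫ x in (-π)..π, sin (n * x) * (ψ x - c) = 0 := by
    intro n
    rcases eq_or_ne n 0 with rfl | hn
    · simp
    · have hn' : (n : ℝ) ≠ 0 := by exact_mod_cast hn
      have := hmul (fun x => -cos (n * x) / n) (by fun_prop) (fun x => by
        simp only
        rw [show (n : ℝ) * (x + 2 * π) = n * x + n * (2 * π) by ring, cos_add_int_mul_two_pi])
      have hd : ∀ x, deriv (fun x => -cos (n * x) / n) x = sin (n * x) := fun x => by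
        have := (((hasDerivAt_id x).const_mul (n : ℝ)).cos.neg.div_const (n : ℝ)).deriv
        simp only [id] at this
        refine Eq.trans this ?_
        field_simp
      simpa only [hd] using this
  have hcoeff : ∀ n : ℤ, fourierCoeffOn hlt F n = 0 := by
    intro n
    have hi : IntervalIntegrable (fun x => ψ x - c) volume (-π) π := hψi.sub (by simp)
    have hi1 : IntervalIntegrable (fun x => cos (n * x) * (ψ x - c)) volume (-π) π :=
      hi.continuousOn_mul (by fun_prop)
    have hi2 : IntervalIntegrable (fun x => sin (n * x) * (ψ x - c)) volume (-π) π :=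
      hi.continuousOn_mul (by fun_prop)
    have hpt : ∀ x : ℝ, fourier (-n) (x : AddCircle (π - -π)) • F x
        = ((cos (n * x) * (ψ x - c) : ℝ) : ℂ) - Complex.I * ((sin (n * x) * (ψ x - c) : ℝ) : ℂ) := by
      intro x
      have : 2 * (π : ℂ) * Complex.I * ((-n : ℤ) : ℂ) * (x : ℂ) / ((π - -π : ℝ) : ℂ)
          = ((-(n * x) : ℝ) : ℂ) * Complex.I := by
        have : (π : ℂ) ≠ 0 := by exact_mod_cast pi_ne_zero
        push_cast
        rw [sub_neg_eq_add, ← two_mul]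
        field_simp
      rw [fourier_coe_apply, this, Complex.exp_mul_I, ← Complex.ofReal_cos, ← Complex.ofReal_sin,
        cos_neg, sin_neg]
      simp only [F, smul_eq_mul]
      push_cast
      ring
    have hofReal : ∀ {p : ℝ → ℝ}, IntervalIntegrable p volume (-π) π →
        IntervalIntegrable (fun x => (p x : ℂ)) volume (-π) π :=
      fun hp => ⟨Integrable.ofReal hp.1, Integrable.ofReal hp.2⟩
    rw [fourierCoeffOn_eq_integral]
    simp only [hpt]
    rw [intervalIntegral.integral_sub (hofReal hi1) ((hofReal hi2).const_mul _),
      intervalIntegral.integral_const_mul, intervalIntegral.integral_ofReal,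
      intervalIntegral.integral_ofReal, hcos, hsin]
    simp
  have hsum := hasSum_sq_fourierCoeffOn hlt hF
  simp only [hcoeff, norm_zero, ne_eq, OfNat.ofNat_ne_zero, not_false_eq_true, zero_pow] at hsum
  have h0 := hsum.unique hasSum_zero
  have h1 : ∫ x in (-π)..π, ‖F x‖ ^ 2 = 0 := by
    rw [smul_eq_mul] at h0
    exact (mul_eq_zero.1 h0).resolve_left (inv_ne_zero (by linarith [pi_pos]))
  rw [intervalIntegral.integral_of_le hlt.le,
    integral_eq_zero_iff_of_nonneg (fun x => by positivity) hF.norm.integrable_sq] at h1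
  refine ⟨c, ?_⟩
  filter_upwards [h1] with x hx
  have : ‖F x‖ = 0 := by simpa using hx
  simp only [F, norm_eq_zero, Complex.ofReal_eq_zero] at this
  linarith

/-- The absolutely continuous representative of an element of `H¹(𝕋)`. -/
theorem IsH1Torus.exists_absolutelyContinuous_rep {φ dφ : ℝ → ℝ} (hφ : IsH1Torus φ dφ) :
    ∃ f : ℝ → ℝ, AbsolutelyContinuousOnInterval f (-π) π ∧
      (∀ᵐ x, x ∈ Set.uIcc (-π) π → HasDerivAt f (dφ x) x) ∧ f π = f (-π) ∧
      ∀ᵐ x ∂(volume.restrict (Set.Ioc (-π) π)), φ x = f x := by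
  have hlt : -π < π := by linarith [pi_pos]
  have hdi : IntervalIntegrable dφ volume (-π) π :=
    (intervalIntegrable_iff_integrableOn_Ioc_of_le hlt.le).2
      (hφ.memLp_deriv.integrable (by norm_num))
  have hφi : IntervalIntegrable φ volume (-π) π :=
    (intervalIntegrable_iff_integrableOn_Ioc_of_le hlt.le).2
      (hφ.memLp.integrable (by norm_num))
  let g : ℝ → ℝ := fun x => ∫ t in (-π)..x, dφ t
  have hgac : AbsolutelyContinuousOnInterval g (-π) π :=
    hdi.absolutelyContinuousOnInterval_intervalIntegral (by simp)
  have hgd : ∀ᵐ x, x ∈ Set.uIcc (-π) π → HasDerivAt g (dφ x) x := by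
    filter_upwards [hdi.ae_hasDerivAt_integral] with x hx hxI
    exact hx hxI (-π) (by simp)
  have hg0 : g (-π) = 0 := by simp [g]
  -- The constant test function shows that `dφ` has mean zero.
  have hg1 : g π = 0 := by
    have := hφ.weak_deriv (fun _ => 1) contDiff_const (fun _ => rfl)
    simp only [deriv_const, mul_zero, intervalIntegral.integral_zero, mul_one] at this
    simp only [g]
    linarith
  have hgL : MemLp g 2 (volume.restrict (Set.Ioc (-π) π)) := by
    have hgc : ContinuousOn g (Set.Icc (-π) π) := by
      simpa [Set.uIcc_of_le hlt.le] using hgac.continuousOn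
    obtain ⟨B, hB⟩ := isCompact_Icc.exists_bound_of_continuousOn hgc
    refine MemLp.of_bound ((hgc.mono Set.Ioc_subset_Icc_self).aestronglyMeasurable
      measurableSet_Ioc) B ?_
    exact (ae_restrict_mem measurableSet_Ioc).mono fun x hx => hB x (Set.Ioc_subset_Icc_self hx)
  obtain ⟨c, hc⟩ := ae_eq_const_of_integral_mul_deriv_eq_zero (hφ.memLp.sub hgL) (by
    intro η hη hper
    have hη' : Continuous (deriv η) := hη.continuous_deriv (by simp)
    have hηac : AbsolutelyContinuousOnInterval η (-π) π :=
      (hη.of_le (by simp)).contDiffOn.absolutelyContinuousOnInterval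
    have hparts := hgac.integral_mul_deriv_eq_deriv_mul hηac
    have hcongr : ∫ x in (-π)..π, deriv g x * η x = ∫ x in (-π)..π, dφ x * η x := by
      apply intervalIntegral.integral_congr_ae
      filter_upwards [hgd] with x hx hxI
      rw [(hx (Set.uIoc_subset_uIcc hxI)).deriv]
    rw [hcongr, hg0, hg1] at hparts
    have hweak := hφ.weak_deriv η hη hper
    simp only [Pi.sub_apply, sub_mul]
    rw [intervalIntegral.integral_sub (hφi.mul_continuousOn hη'.continuousOn)
      ((hη'.intervalIntegrable _ _).continuousOn_mul hgac.continuousOn), hweak, hparts]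
    ring)
  refine ⟨fun x => c + g x, ?_, ?_, by simp [hg0, hg1], ?_⟩
  · have : AbsolutelyContinuousOnInterval (fun _ : ℝ => c) (-π) π :=
      contDiffOn_const.absolutelyContinuousOnInterval
    exact this.fun_add hgac
  · filter_upwards [hgd] with x hx hxI
    exact (hx hxI).const_add c
  · filter_upwards [hc] with x hx
    simp only [Pi.sub_apply] at hx
    linarith

/-- For an odd element of `H¹(𝕋)`, the continuous representative also vanishes at `-π`, `0` and
`π`. -/
theorem IsH1Torus.exists_absolutelyContinuous_rep_of_odd {φ dφ : ℝ → ℝ} (hφ : IsH1Torus φ dφ)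
    (hodd : ∀ᵐ x : ℝ, φ (-x) = -φ x) :
    ∃ f : ℝ → ℝ, AbsolutelyContinuousOnInterval f (-π) π ∧
      (∀ᵐ x, x ∈ Set.uIcc (-π) π → HasDerivAt f (dφ x) x) ∧ f (-π) = 0 ∧ f 0 = 0 ∧ f π = 0 ∧
      ∀ᵐ x ∂(volume.restrict (Set.Ioc (-π) π)), φ x = f x := by
  obtain ⟨f, hf, hfd, hper, hφf⟩ := hφ.exists_absolutelyContinuous_rep
  have hlt : -π < π := by linarith [pi_pos]
  have hfc : ContinuousOn f (Set.Icc (-π) π) := by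
    simpa [Set.uIcc_of_le hlt.le] using hf.continuousOn
  have hfneg : ContinuousOn (fun x => f (-x)) (Set.Icc (-π) π) :=
    hfc.comp continuous_neg.continuousOn fun x hx => ⟨by linarith [hx.2], by linarith [hx.1]⟩
  have hae : ∀ᵐ x, x ∈ Set.Ioc (-π) π → φ x = f x := (ae_restrict_iff' measurableSet_Ioc).1 hφf
  have hae' : ∀ᵐ x : ℝ, -x ∈ Set.Ioc (-π) π → φ (-x) = f (-x) :=
    (Measure.measurePreserving_neg volume).quasiMeasurePreserving.ae hae
  have hEq : Set.EqOn (fun x => f (-x)) (fun x => -f x) (Set.Icc (-π) π) := by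
    refine Measure.eqOn_Icc_of_ae_eq (μ := volume) hlt.ne ?_ hfneg hfc.neg
    rw [Measure.restrict_congr_set Ioo_ae_eq_Icc.symm, Filter.EventuallyEq,
      ae_restrict_iff' measurableSet_Ioo]
    filter_upwards [hae, hae', hodd] with x h1 h2 h3 hx
    rw [← h1 ⟨hx.1, hx.2.le⟩, ← h2 ⟨by linarith [hx.2], by linarith [hx.1]⟩, h3]
  have h0 := hEq (x := 0) ⟨by linarith, by linarith⟩
  have hπ := hEq (x := π) ⟨by linarith, le_rfl⟩
  simp only [neg_zero] at h0 hπ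
  exact ⟨f, hf, hfd, by linarith, by linarith, by linarith, hφf⟩

/-! ### Coercivity of the quadratic form -/

/-- A positive strict supersolution on `[0, π]` bounds the quadratic form of an even potential from
below in `L²` on the odd part of `H¹(𝕋)`. -/
theorem IsH1Torus.mul_integral_sq_le_of_supersolution {κ c : ℝ} {V w φ dφ : ℝ → ℝ}
    (hφ : IsH1Torus φ dφ) (hodd : ∀ᵐ x : ℝ, φ (-x) = -φ x) (hV : Continuous V)
    (hVe : Function.Even V) (hw : ContDiff ℝ 2 w) (hw0 : ∀ x ∈ Set.Icc 0 π, 0 < w x)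
    (hc : ∀ x ∈ Set.Icc 0 π, c * w x ≤ V x * w x - κ ^ 2 * deriv (deriv w) x) :
    c * ∫ x in (-π)..π, φ x ^ 2 ≤
      (∫ x in (-π)..π, κ ^ 2 * dφ x ^ 2) + ∫ x in (-π)..π, V x * φ x ^ 2 := by
  obtain ⟨f, hf, hfd, hf1, hf2, hf3, hφf⟩ := hφ.exists_absolutelyContinuous_rep_of_odd hodd
  have hpi := pi_pos
  have hlt : -π < π := by linarith
  have hd2 : IntervalIntegrable (fun x => dφ x ^ 2) volume (-π) π :=
    (intervalIntegrable_iff_integrableOn_Ioc_of_le hlt.le).2 hφ.memLp_deriv.integrable_sq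
  have hu : Set.uIcc (-π) π = Set.Icc (-π) π := Set.uIcc_of_le hlt.le
  have hs1 : Set.uIcc (-π) 0 ⊆ Set.uIcc (-π) π := by
    rw [hu, Set.uIcc_of_le (by linarith)]
    exact Set.Icc_subset_Icc_right hpi.le
  have hs2 : Set.uIcc 0 π ⊆ Set.uIcc (-π) π := by
    rw [hu, Set.uIcc_of_le hpi.le]
    exact Set.Icc_subset_Icc_left (by linarith)
  have hfc := hf.continuousOn
  have hif : IntervalIntegrable (fun x => f x ^ 2) volume (-π) π :=
    ContinuousOn.intervalIntegrable (by fun_prop)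
  have hiV : IntervalIntegrable (fun x => V x * f x ^ 2) volume (-π) π :=
    ContinuousOn.intervalIntegrable (by fun_prop)
  have hiQ : IntervalIntegrable (fun x => κ ^ 2 * dφ x ^ 2 + V x * f x ^ 2) volume (-π) π :=
    (hd2.const_mul _).add hiV
  have hright := (hf.mono hs2).mul_integral_sq_le_of_supersolution (κ := κ) hpi.le
    (hfd.mono fun x hx hxI => hx (hs2 hxI)) (hd2.mono_set hs2) hf2 hf3 hV hw hw0 hc
  have ddw : ∀ x, deriv (deriv fun y => w (-y)) x = deriv (deriv w) (-x) := by
    intro x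
    have : deriv (fun y => w (-y)) = fun y => -deriv w (-y) := funext fun y => deriv_comp_neg w y
    rw [this, deriv.fun_neg, deriv_comp_neg (deriv w), neg_neg]
  have hleft := (hf.mono hs1).mul_integral_sq_le_of_supersolution (κ := κ) (w := fun y => w (-y))
    (c := c) (by linarith) (hfd.mono fun x hx hxI => hx (hs1 hxI)) (hd2.mono_set hs1) hf1 hf2 hV
    (hw.comp contDiff_neg) (fun x hx => hw0 (-x) ⟨by linarith [hx.2], by linarith [hx.1]⟩)
    (fun x hx => by
      rw [ddw, ← hVe x]
      exact hc (-x) ⟨by linarith [hx.2], by linarith [hx.1]⟩)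
  have e1 : ∫ x in (-π)..π, φ x ^ 2 = ∫ x in (-π)..π, f x ^ 2 := by
    rw [intervalIntegral.integral_of_le hlt.le, intervalIntegral.integral_of_le hlt.le]
    exact integral_congr_ae (hφf.mono fun x hx => by simp only [hx])
  have e2 : ∫ x in (-π)..π, V x * φ x ^ 2 = ∫ x in (-π)..π, V x * f x ^ 2 := by
    rw [intervalIntegral.integral_of_le hlt.le, intervalIntegral.integral_of_le hlt.le]
    exact integral_congr_ae (hφf.mono fun x hx => by simp only [hx])
  rw [e1, e2, ← intervalIntegral.integral_add (hd2.const_mul _) hiV,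
    ← intervalIntegral.integral_add_adjacent_intervals (hif.mono_set hs1) (hif.mono_set hs2),
    ← intervalIntegral.integral_add_adjacent_intervals (hiQ.mono_set hs1) (hiQ.mono_set hs2)]
  linarith

/-- The quadratic form controls `∫ φ'²` up to a multiple of `∫ φ²`, which is what upgrades an `L²`
lower bound to an `H¹` one. -/
theorem IsH1Torus.integral_sub_integral_sq_le {κ : ℝ} {V φ dφ : ℝ → ℝ}
    (hφ : IsH1Torus φ dφ) (hV : Continuous V) (hV1 : ∀ x, -1 ≤ V x) :
    κ ^ 2 * (∫ x in (-π)..π, dφ x ^ 2) - ∫ x in (-π)..π, φ x ^ 2 ≤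
      (∫ x in (-π)..π, κ ^ 2 * dφ x ^ 2) + ∫ x in (-π)..π, V x * φ x ^ 2 := by
  have hlt : -π < π := by linarith [pi_pos]
  have hi : IntervalIntegrable (fun x => φ x ^ 2) volume (-π) π :=
    (intervalIntegrable_iff_integrableOn_Ioc_of_le hlt.le).2 hφ.memLp.integrable_sq
  rw [intervalIntegral.integral_const_mul, sub_eq_add_neg, ← intervalIntegral.integral_neg]
  gcongr
  refine intervalIntegral.integral_mono_on hlt.le hi.neg (hi.continuousOn_mul hV.continuousOn)
    fun x _ => ?_
  nlinarith [hV1 x, sq_nonneg (φ x)]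

theorem lemma4p1 (κ : ℝ) (hκ0 : 0 < κ) (hκ1 : κ < 1) :
    ∃ C : ℝ, 0 < C ∧ ∀ U : ℝ → ℝ, IsOddZeroUpGroundState κ U →
      ∀ φ dφ : ℝ → ℝ, IsH1Torus φ dφ → (∀ᵐ x : ℝ, φ (-x) = -φ x) →
        C * h1NormSq φ dφ ≤
          (∫ x in (-π)..π, κ ^ 2 * dφ x ^ 2) +
            ∫ x in (-π)..π, (3 * U x ^ 2 - 1) * φ x ^ 2 := by
  obtain ⟨U₀, hU₀⟩ := exists_isOddZeroUpGroundState hκ0 hκ1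
  obtain ⟨w, hw, hw0, c, hc, hcw⟩ := hU₀.exists_supersolution hκ0
  -- The weight `t` is chosen so that `(1 - t) c - t = c / 2`.
  set t := c / (2 * (1 + c)) with ht
  have ht0 : 0 < t := by positivity
  have ht1 : t ≤ 1 := by rw [ht, div_le_one (by positivity)]; linarith
  have htc : (1 - t) * c - t = c / 2 := by rw [ht]; field_simp; ring
  refine ⟨min (t * κ ^ 2) (c / 2), lt_min (by positivity) (by positivity), ?_⟩
  intro U hU φ dφ hφ hodd
  obtain rfl : U = U₀ := hU.unique hκ0.ne' hU₀
  have hUc : Continuous U := hU.contDiff.continuous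
  have hV : Continuous fun x => 3 * U x ^ 2 - 1 := by fun_prop
  have h1 := hφ.mul_integral_sq_le_of_supersolution hodd hV
    (fun x => by simp only [hU.odd x, neg_sq]) hw hw0 hcw
  have h2 := hφ.integral_sub_integral_sq_le (κ := κ) hV fun x => by nlinarith [sq_nonneg (U x)]
  have hA : 0 ≤ ∫ x in (-π)..π, φ x ^ 2 :=
    intervalIntegral.integral_nonneg (by linarith [pi_pos]) fun x _ => sq_nonneg _
  have hD : 0 ≤ ∫ x in (-π)..π, dφ x ^ 2 :=
    intervalIntegral.integral_nonneg (by linarith [pi_pos]) fun x _ => sq_nonneg _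
  unfold h1NormSq
  set A := ∫ x in (-π)..π, φ x ^ 2
  set D := ∫ x in (-π)..π, dφ x ^ 2
  set Q := (∫ x in (-π)..π, κ ^ 2 * dφ x ^ 2) + ∫ x in (-π)..π, (3 * U x ^ 2 - 1) * φ x ^ 2
  calc min (t * κ ^ 2) (c / 2) * (A + D)
      = min (t * κ ^ 2) (c / 2) * A + min (t * κ ^ 2) (c / 2) * D := mul_add _ _ _
    _ ≤ c / 2 * A + t * κ ^ 2 * D := by
        gcongr
        · exact min_le_right _ _
        · exact min_le_left _ _
    _ = t * (κ ^ 2 * D - A) + (1 - t) * (c * A) := by rw [← htc]; ring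
    _ ≤ t * Q + (1 - t) * Q := by
        have := sub_nonneg.2 ht1
        gcongr
    _ = Q := by ring
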